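/- The following is a theorem of homotopy type theory (Martin-Löf type theory with a cumulative hierarchy of univalent universes $\mathcal U_0 : \mathcal U_1 : \cdots$, propositional truncation $\|{-}\|$ and nullification), for every universe $\mathcal U=\mathcal U_k$. A (small) collection of types is a map $T : I \to \mathcal U$ with $I : \mathcal U$; write $X \in T$ for $\exists_{i : I}\, (T(i) = X)$, where $\exists_{x:A}B(x) := \|\sum_{x:A}B(x)\|$. The collection $T$ is a presentation if $1 \in T$ and, whenever $X \in T$ and $B : X \to \mathcal U$ satisfies $B(x) \in T$ for all $x : X$, also $\sum_{x:X} B(x) \in T$. A type $X : \mathcal U$ is projective if for every $B : X \to \mathcal U$ with $\prod_{x:X}\|B(x)\|$ one has $\|\prod_{x:X}B(x)\|$. A projective presentation is a presentation $T$ such that every $X\in T$ is projective. A type $Y$ is a $T$-sheaf if for every $i : I$ the diagonal map $Y \to (\|T(i)\| \to Y)$ is an equivalence. The $T$-sheafification $\bigcirc_T X$ of $X : \mathcal U$ is the nullification of $X$ at the family $i \mapsto \|T(i)\|$: it is a $T$-sheaf with a map $\eta : X \to \bigcirc_T X$ such that $-\circ\eta : (\bigcirc_T X \to Y) \to (X \to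 Y)$ is an equivalence for every $T$-sheaf $Y : \mathcal U$. Lemma. Let $T$ be a projective presentation and let $P : \mathcal U$ be a proposition. Then $$\bigcirc_T P \;=\; \exists_{A \in T}\, P^A .$$ Here $P^A$ is the type of functions $A \to P$, and the right-hand side may be read either as $\exists_{i : I}\,(T(i) \to P)$, with the equality in $\mathcal U_k$, or as $\exists_{A : \mathcal U_k}\,\big((A \in T) \times (A \to P)\big)$, with the equality in $\mathcal U_{k+1}$; both equalities hold. -/

import Mathlib

/-!
# Homotopy type theory as a formal system

Lean's own types satisfy uniqueness of identity proofs and the axiom of choice, so statements of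
homotopy type theory cannot be read directly in `Type`. This file defines homotopy type theory
itself, in the style of the "first presentation" in the appendix of the HoTT book: terms built
from variables, universes, `Π`, `λ`, application and primitive constants, a convertibility
relation, and the judgement `Γ ⊢ t : A`. A theorem of homotopy type theory is a closed type for
which some closed term can be derived.

Besides `Π` and a cumulative hierarchy of universes there are: `Σ`, `+`, `0`, `1`, `ℕ`,
identity types, function extensionality, univalence, propositional truncation, nullification.
-/

namespace HoTT

/-- The primitive constants. Universe levels are not recorded, except in the univalence axiom. -/
inductive Const : Type
  | sigma | pair | sigmaInd
  | sum | inl | inr | sumInd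
  | empty | emptyInd
  | unit | star | unitInd
  | nat | zero | succ | natInd
  | id | refl | idInd
  | funext | univalence (k : ℕ)
  | trunc | truncIn | truncEq | truncRec
  | null | nullIn | nullIsNull | nullRec
  deriving DecidableEq

/-- Raw terms, with de Bruijn indices. Types are terms too (universes à la Russell). -/
inductive Tm : Type
  | var (n : ℕ)
  | univ (k : ℕ)
  | pi (A B : Tm)
  | lam (b : Tm)
  | app (f a : Tm)
  | const (c : Const)
  deriving DecidableEq

namespace Tm

/-- The renaming under a binder. -/
def upRen (ρ : ℕ → ℕ) : ℕ → ℕ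
  | 0 => 0
  | n + 1 => ρ n + 1

/-- Renaming of variables. -/
def rename : (ℕ → ℕ) → Tm → Tm
  | ρ, var n => var (ρ n)
  | _, univ k => univ k
  | ρ, pi A B => pi (rename ρ A) (rename (upRen ρ) B)
  | ρ, lam b => lam (rename (upRen ρ) b)
  | ρ, app f a => app (rename ρ f) (rename ρ a)
  | _, const c => const c

/-- The substitution under a binder. -/
def upSubst (σ : ℕ → Tm) : ℕ → Tm
  | 0 => var 0
  | n + 1 => rename Nat.succ (σ n)

/-- Simultaneous capture-avoiding substitution. -/
def subst : (ℕ → Tm) → Tm → Tm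
  | σ, var n => σ n
  | _, univ k => univ k
  | σ, pi A B => pi (subst σ A) (subst (upSubst σ) B)
  | σ, lam b => lam (subst (upSubst σ) b)
  | σ, app f a => app (subst σ f) (subst σ a)
  | _, const c => const c

/-- The substitution of `a` for the variable with index `0`. -/
def single (a : Tm) : ℕ → Tm
  | 0 => a
  | n + 1 => var n

/-- `b[a/x]`, where `x` is the variable with index `0`. -/
def inst (b a : Tm) : Tm := subst (single a) b

end Tm

/-! ### Convertibility (judgemental equality) -/

infixl:80 " ⋄ " => Tm.app

open Tm in
/-- Convertibility: the congruence on raw terms generated by `β`, `η` and the computation rules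
of the eliminators. -/
inductive Conv : Tm → Tm → Prop
  | refl (t : Tm) : Conv t t
  | symm {t u : Tm} : Conv t u → Conv u t
  | trans {t u v : Tm} : Conv t u → Conv u v → Conv t v
  | pi {A A' B B' : Tm} : Conv A A' → Conv B B' → Conv (pi A B) (pi A' B')
  | lam {b b' : Tm} : Conv b b' → Conv (lam b) (lam b')
  | app {f f' a a' : Tm} : Conv f f' → Conv a a' → Conv (f ⋄ a) (f' ⋄ a')
  | beta (b a : Tm) : Conv (lam b ⋄ a) (b.inst a)
  | eta (f : Tm) : Conv (lam (f.rename Nat.succ ⋄ var 0)) f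
  | sigmaInd (A B C g A' B' a b : Tm) :
      Conv (const .sigmaInd ⋄ A ⋄ B ⋄ C ⋄ g ⋄ (const .pair ⋄ A' ⋄ B' ⋄ a ⋄ b)) (g ⋄ a ⋄ b)
  | sumInd_inl (A B C g h A' B' a : Tm) :
      Conv (const .sumInd ⋄ A ⋄ B ⋄ C ⋄ g ⋄ h ⋄ (const .inl ⋄ A' ⋄ B' ⋄ a)) (g ⋄ a)
  | sumInd_inr (A B C g h A' B' b : Tm) :
      Conv (const .sumInd ⋄ A ⋄ B ⋄ C ⋄ g ⋄ h ⋄ (const .inr ⋄ A' ⋄ B' ⋄ b)) (h ⋄ b)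
  | unitInd (C c : Tm) :
      Conv (const .unitInd ⋄ C ⋄ c ⋄ const .star) c
  | natInd_zero (C c s : Tm) :
      Conv (const .natInd ⋄ C ⋄ c ⋄ s ⋄ const .zero) c
  | natInd_succ (C c s n : Tm) :
      Conv (const .natInd ⋄ C ⋄ c ⋄ s ⋄ (const .succ ⋄ n)) (s ⋄ n ⋄ (const .natInd ⋄ C ⋄ c ⋄ s ⋄ n))
  | idInd (A C c x y A' z : Tm) :
      Conv (const .idInd ⋄ A ⋄ C ⋄ c ⋄ x ⋄ y ⋄ (const .refl ⋄ A' ⋄ z)) (c ⋄ z)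
  | truncRec (A B h f A' a : Tm) :
      Conv (const .truncRec ⋄ A ⋄ B ⋄ h ⋄ f ⋄ (const .truncIn ⋄ A' ⋄ a)) (f ⋄ a)

/-! ### Writing terms with named variables

A `Term` is a raw term that may be placed under any number `d` of binders. Binders of the object
theory are written with Lean's `fun`; the variable bound at depth `d` is, at depth `e > d`, the
de Bruijn index `e - (d + 1)`. -/

/-- A raw term as a function of the number of binders above it. -/
abbrev Term : Type := ℕ → Tm

/-- The universe `U k`. -/
def U (k : ℕ) : Term := fun _ => .univ k

/-- A primitive constant. -/
def cst (c : Const) : Term := fun _ => .const c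

/-- Application. -/
def ap (f a : Term) : Term := fun d => .app (f d) (a d)

infixl:80 " ⬝ " => ap

/-- The variable bound at depth `d`. -/
def bvar (d : ℕ) : Term := fun e => .var (e - (d + 1))

/-- `Π (x : A), B x`. -/
def Pi (A : Term) (B : Term → Term) : Term := fun d => .pi (A d) (B (bvar d) (d + 1))

/-- `λ x, b x`. -/
def Lam (b : Term → Term) : Term := fun d => .lam (b (bvar d) (d + 1))

/-- The type of functions `A → B`. -/
def Arr (A B : Term) : Term := Pi A fun _ => B

infixr:60 " ⇒ " => Arr

/-- `Σ (x : A), B x`. -/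
def Sig (A : Term) (B : Term → Term) : Term := cst .sigma ⬝ A ⬝ Lam B

/-- The pair `(a, b) : Σ (x : A), B x`. -/
def Pair (A : Term) (B : Term → Term) (a b : Term) : Term := cst .pair ⬝ A ⬝ Lam B ⬝ a ⬝ b

/-- `A × B`. -/
def Prod (A B : Term) : Term := Sig A fun _ => B

/-- `A + B`. -/
def Sum (A B : Term) : Term := cst .sum ⬝ A ⬝ B

/-- The identity type `x =_A y`. -/
def Id (A x y : Term) : Term := cst .id ⬝ A ⬝ x ⬝ y

/-- `refl_x : x =_A x`. -/
def Refl (A x : Term) : Term := cst .refl ⬝ A ⬝ x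

/-- The propositional truncation `‖A‖`. -/
def Trunc (A : Term) : Term := cst .trunc ⬝ A

/-- `∃ (x : A), B x`, that is `‖Σ (x : A), B x‖`. -/
def Ex (A : Term) (B : Term → Term) : Term := Trunc (Sig A B)

/-- `A` is a (mere) proposition. -/
def IsProp (A : Term) : Term := Pi A fun x => Pi A fun y => Id A x y

/-- The map `x ↦ f x` from `A` to `B` is an equivalence: it has a right and a left inverse. -/
def IsEquiv (A B : Term) (f : Term → Term) : Term :=
  Prod (Sig (B ⇒ A) fun g => Pi B fun y => Id B (f (g ⬝ y)) y)
    (Sig (B ⇒ A) fun h => Pi A fun x => Id A (h ⬝ f x) x)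

/-- The type of equivalences `A ≃ B`. -/
def Equiv (A B : Term) : Term := Sig (A ⇒ B) fun f => IsEquiv A B fun x => f ⬝ x

/-- The identity equivalence `A ≃ A`. -/
def idEquiv (A : Term) : Term :=
  Pair (A ⇒ A) (fun f => IsEquiv A A fun x => f ⬝ x) (Lam fun x => x)
    (Pair (Sig (A ⇒ A) fun g => Pi A fun y => Id A (g ⬝ y) y)
      (fun _ => Sig (A ⇒ A) fun h => Pi A fun x => Id A (h ⬝ x) x)
      (Pair (A ⇒ A) (fun g => Pi A fun y => Id A (g ⬝ y) y) (Lam fun x => x)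
        (Lam fun x => Refl A x))
      (Pair (A ⇒ A) (fun h => Pi A fun x => Id A (h ⬝ x) x) (Lam fun x => x)
        (Lam fun x => Refl A x)))

/-- The canonical map `(A =_{U k} B) → (A ≃ B)`, by path induction. -/
def idToEquiv (k : ℕ) (A B p : Term) : Term :=
  cst .idInd ⬝ U k ⬝ (Lam fun X => Lam fun Y => Lam fun _ => Equiv X Y) ⬝
    (Lam fun X => idEquiv X) ⬝ A ⬝ B ⬝ p

/-- The canonical map `(f = g) → Π (x : A), f x = g x`, by path induction. -/
def happly (A B f g p : Term) : Term :=
  cst .idInd ⬝ (Pi A fun x => B ⬝ x) ⬝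
    (Lam fun f => Lam fun g => Lam fun _ => Pi A fun x => Id (B ⬝ x) (f ⬝ x) (g ⬝ x)) ⬝
    (Lam fun f => Lam fun x => Refl (B ⬝ x) (f ⬝ x)) ⬝ f ⬝ g ⬝ p

/-- `Y` is `B`-null, for `B : A → U`: for all `a : A` the diagonal map `Y → (B a → Y)` is an
equivalence. -/
def IsNull (A B Y : Term) : Term :=
  Pi A fun a => IsEquiv Y (B ⬝ a ⇒ Y) fun y => Lam fun _ => y

/-- The nullification of `X` at the family `B : A → U`. -/
def Null (A B X : Term) : Term := cst .null ⬝ A ⬝ B ⬝ X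

/-- The unit `X → Null A B X` of nullification. -/
def nullUnit (A B X x : Term) : Term := cst .nullIn ⬝ A ⬝ B ⬝ X ⬝ x

/-! ### Types of the constants -/

/-- The types of the constants, for universe levels `k` and `l`. Each constant has its type for all
`k` and `l` (typical ambiguity). -/
def Const.type (k l : ℕ) : Const → Term
  | sigma => Pi (U k) fun A => (A ⇒ U k) ⇒ U k
  | pair => Pi (U k) fun A => Pi (A ⇒ U k) fun B => Pi A fun a => Pi (B ⬝ a) fun _ =>
      cst .sigma ⬝ A ⬝ B
  | sigmaInd => Pi (U k) fun A => Pi (A ⇒ U k) fun B => Pi (cst .sigma ⬝ A ⬝ B ⇒ U l) fun C =>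
      (Pi A fun a => Pi (B ⬝ a) fun b => C ⬝ (cst .pair ⬝ A ⬝ B ⬝ a ⬝ b)) ⇒
      Pi (cst .sigma ⬝ A ⬝ B) fun z => C ⬝ z
  | sum => U k ⇒ U k ⇒ U k
  | inl => Pi (U k) fun A => Pi (U k) fun B => A ⇒ Sum A B
  | inr => Pi (U k) fun A => Pi (U k) fun B => B ⇒ Sum A B
  | sumInd => Pi (U k) fun A => Pi (U k) fun B => Pi (Sum A B ⇒ U l) fun C =>
      (Pi A fun a => C ⬝ (cst .inl ⬝ A ⬝ B ⬝ a)) ⇒ (Pi B fun b => C ⬝ (cst .inr ⬝ A ⬝ B ⬝ b)) ⇒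
      Pi (Sum A B) fun z => C ⬝ z
  | empty => U 0
  | emptyInd => Pi (cst .empty ⇒ U l) fun C => Pi (cst .empty) fun x => C ⬝ x
  | unit => U 0
  | star => cst .unit
  | unitInd => Pi (cst .unit ⇒ U l) fun C => C ⬝ cst .star ⇒ Pi (cst .unit) fun x => C ⬝ x
  | nat => U 0
  | zero => cst .nat
  | succ => cst .nat ⇒ cst .nat
  | natInd => Pi (cst .nat ⇒ U l) fun C => C ⬝ cst .zero ⇒
      (Pi (cst .nat) fun n => C ⬝ n ⇒ C ⬝ (cst .succ ⬝ n)) ⇒ Pi (cst .nat) fun n => C ⬝ n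
  | id => Pi (U k) fun A => A ⇒ A ⇒ U k
  | refl => Pi (U k) fun A => Pi A fun x => Id A x x
  | idInd => Pi (U k) fun A => Pi (Pi A fun x => Pi A fun y => Id A x y ⇒ U l) fun C =>
      (Pi A fun x => C ⬝ x ⬝ x ⬝ Refl A x) ⇒
      Pi A fun x => Pi A fun y => Pi (Id A x y) fun p => C ⬝ x ⬝ y ⬝ p
  | funext => Pi (U k) fun A => Pi (A ⇒ U k) fun B =>
      Pi (Pi A fun x => B ⬝ x) fun f => Pi (Pi A fun x => B ⬝ x) fun g =>
      IsEquiv (Id (Pi A fun x => B ⬝ x) f g) (Pi A fun x => Id (B ⬝ x) (f ⬝ x) (g ⬝ x))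
        fun p => happly A B f g p
  | univalence j => Pi (U j) fun A => Pi (U j) fun B =>
      IsEquiv (Id (U j) A B) (Equiv A B) fun p => idToEquiv j A B p
  | trunc => U k ⇒ U k
  | truncIn => Pi (U k) fun A => A ⇒ Trunc A
  | truncEq => Pi (U k) fun A => IsProp (Trunc A)
  | truncRec => Pi (U k) fun A => Pi (U l) fun B => IsProp B ⇒ (A ⇒ B) ⇒ Trunc A ⇒ B
  | null => Pi (U k) fun A => (A ⇒ U k) ⇒ U k ⇒ U k
  | nullIn => Pi (U k) fun A => Pi (A ⇒ U k) fun B => Pi (U k) fun X => X ⇒ Null A B X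
  | nullIsNull => Pi (U k) fun A => Pi (A ⇒ U k) fun B => Pi (U k) fun X =>
      IsNull A B (Null A B X)
  | nullRec => Pi (U k) fun A => Pi (A ⇒ U k) fun B => Pi (U k) fun X => Pi (U k) fun Y =>
      IsNull A B Y ⇒
      IsEquiv (Null A B X ⇒ Y) (X ⇒ Y) fun f => Lam fun x => f ⬝ nullUnit A B X x

/-! ### The typing judgement -/

/-- `HasType Γ t A` is the judgement `Γ ⊢ t : A`. The head of the list `Γ` is the type of the
variable with index `0`. There is no separate judgement that a context is well formed: every rule
that extends a context has a premise that the new entry is a type, so only well-formed contexts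
occur in a derivation that ends in the empty context. -/
inductive HasType : List Tm → Tm → Tm → Prop
  | var {Γ : List Tm} {n : ℕ} {A : Tm} :
      Γ[n]? = some A → HasType Γ (.var n) (A.rename fun m => m + (n + 1))
  | univ (Γ : List Tm) (k : ℕ) : HasType Γ (.univ k) (.univ (k + 1))
  | cumul {Γ : List Tm} {A : Tm} {k : ℕ} :
      HasType Γ A (.univ k) → HasType Γ A (.univ (k + 1))
  | pi {Γ : List Tm} {A B : Tm} {k : ℕ} :
      HasType Γ A (.univ k) → HasType (A :: Γ) B (.univ k) → HasType Γ (.pi A B) (.univ k)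
  | lam {Γ : List Tm} {A B b : Tm} {k : ℕ} :
      HasType Γ A (.univ k) → HasType (A :: Γ) b B → HasType Γ (.lam b) (.pi A B)
  | app {Γ : List Tm} {A B f a : Tm} :
      HasType Γ f (.pi A B) → HasType Γ a A → HasType Γ (.app f a) (B.inst a)
  | const (Γ : List Tm) (c : Const) (k l : ℕ) : HasType Γ (.const c) (c.type k l 0)
  | conv {Γ : List Tm} {t A B : Tm} {k : ℕ} :
      HasType Γ t A → Conv A B → HasType Γ B (.univ k) → HasType Γ t B

/-- `A` is a theorem of homotopy type theory: a closed term of the closed type `A` is derivable. -/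
def Provable (A : Term) : Prop := ∃ t : Tm, HasType [] t (A 0)

/-! ### Presentations of modalities

A collection of types is a map `T : I → U k`; here `I : U k`, so it is a small collection. -/

/-- `X ∈ T`, that is `∃ (i : I), T i = X`. -/
def Mem (k : ℕ) (I T X : Term) : Term := Ex I fun i => Id (U k) (T ⬝ i) X

/-- `T` is a presentation: `1 ∈ T`, and `Σ (x : X), B x` is in `T` whenever `X` and all `B x`
are. -/
def IsPresentation (k : ℕ) (I T : Term) : Term :=
  Prod (Mem k I T (cst .unit))
    (Pi (U k) fun X => Pi (X ⇒ U k) fun B =>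
      Mem k I T X ⇒ (Pi X fun x => Mem k I T (B ⬝ x)) ⇒ Mem k I T (Sig X fun x => B ⬝ x))

/-- `X` is projective: it satisfies the axiom of choice for all families `B : X → U k`. -/
def IsProjective (k : ℕ) (X : Term) : Term :=
  Pi (X ⇒ U k) fun B => (Pi X fun x => Trunc (B ⬝ x)) ⇒ Trunc (Pi X fun x => B ⬝ x)

/-- `T` is a projective presentation: a presentation all of whose members are projective. -/
def IsProjectivePresentation (k : ℕ) (I T : Term) : Term :=
  Prod (IsPresentation k I T) (Pi (U k) fun X => Mem k I T X ⇒ IsProjective k X)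

/-- The `T`-sheafification of `X`: its nullification at the propositions `‖T i‖`. -/
def Sheafification (I T X : Term) : Term := Null I (Lam fun i => Trunc (T ⬝ i)) X

end HoTT

namespace HoTT

/-! ### Substitution and level shifting -/

namespace Tm

/-! Inside homotopy type theory the argument is short. Let `N` be the sheafification of `P` and `Q`
the truncation of the type of pairs of `i : I` and a map `T i → P`. The key point is that `Q` is a
sheaf. Given `‖T i‖ → Q`, restrict it to `T i`. Projectivity of `T i` merely gives a choice of `j t
: I` and `T (j t) → P` for each `t : T i`. These maps combine into one map to `P` from the sum of
the `T (j t)` over `t`, and this sum is again in `T`. So `Q` holds (`localCover_inhabited`), and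
since both sides are propositions the diagonal is an equivalence. As `1 ∈ T`, there is a map `P →
Q`, which extends along the unit to `N → Q`. Conversely `N` is a proposition, so `T i → P` induces
`‖T i‖ → N`, which has a value in `N` because `N` is a sheaf. Propositional extensionality turns the
two implications into an equality. The derivation itself is obtained by reflection. Proof terms
carry annotations that make types inferable; a type checker for them is proved sound for `HasType`
(`isSound_infer`) and is run by the kernel. It runs only on closed terms with numeral levels, so
everything is derived over `U 0` and then raised to `U k` by `HasType.shift`. -/

theorem subst_rename (t : Tm) (ρ : ℕ → ℕ) (σ : ℕ → Tm) :
    (t.rename ρ).subst σ = t.subst fun n => σ (ρ n) := by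
  induction t generalizing ρ σ with
  | var n => rfl
  | univ k => rfl
  | const c => rfl
  | app f a hf ha => simp only [rename, subst, hf, ha]
  | pi A B hA hB =>
    simp only [rename, subst, hA, hB]
    congr 2
    funext n
    cases n <;> rfl
  | lam b hb =>
    simp only [rename, subst, hb]
    congr 2
    funext n
    cases n <;> rfl

theorem subst_var (t : Tm) : t.subst var = t := by
  have up : upSubst var = var := by
    funext n
    cases n <;> rfl
  induction t with
  | var n => rfl
  | univ k => rfl
  | const c => rfl
  | app f a hf ha => simp only [subst, hf, ha]
  | pi A B hA hB => simp only [subst, up, hA, hB]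
  | lam b hb => simp only [subst, up, hb]

theorem inst_rename_succ (t a : Tm) : (t.rename Nat.succ).inst a = t := by
  rw [inst, subst_rename]
  exact subst_var t

end Tm

/-- Raises the level recorded in a constant by `s`. -/
def Const.shift (s : ℕ) : Const → Const
  | .univalence k => .univalence (s + k)
  | c => c

/-- Raises all universe levels in a raw term by `s`. -/
def Tm.shift (s : ℕ) : Tm → Tm
  | .var n => .var n
  -- With `s` on the left, `s + 0` and `s + (k + 1)` reduce to `s` and `(s + k) + 1`, so shifted
  -- types match the typing rules definitionally.
  | .univ k => .univ (s + k)
  | .pi A B => .pi (A.shift s) (B.shift s)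
  | .lam b => .lam (b.shift s)
  | .app f a => .app (f.shift s) (a.shift s)
  | .const c => .const (c.shift s)

namespace Tm

theorem shift_rename (s : ℕ) (t : Tm) (ρ : ℕ → ℕ) :
    (t.rename ρ).shift s = (t.shift s).rename ρ := by
  induction t generalizing ρ with
  | var n => rfl
  | univ k => rfl
  | const c => rfl
  | app f a hf ha => simp only [rename, shift, hf, ha]
  | pi A B hA hB => simp only [rename, shift, hA, hB]
  | lam b hb => simp only [rename, shift, hb]

theorem shift_subst (s : ℕ) (t : Tm) (σ : ℕ → Tm) :
    (t.subst σ).shift s = (t.shift s).subst fun n => (σ n).shift s := by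
  have up (σ : ℕ → Tm) :
      (fun n => (upSubst σ n).shift s) = upSubst fun n => (σ n).shift s := by
    funext n
    cases n with
    | zero => rfl
    | succ n => exact shift_rename s (σ n) Nat.succ
  induction t generalizing σ with
  | var n => rfl
  | univ k => rfl
  | const c => rfl
  | app f a hf ha => simp only [subst, shift, hf, ha]
  | pi A B hA hB => simp only [subst, shift, hA, hB, up]
  | lam b hb => simp only [subst, shift, hb, up]

theorem shift_inst (s : ℕ) (b a : Tm) : (b.inst a).shift s = (b.shift s).inst (a.shift s) := by
  rw [inst, inst, shift_subst]
  congr 1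
  funext n
  cases n <;> rfl

end Tm

theorem Conv.shift (s : ℕ) {t u : Tm} (h : Conv t u) : Conv (t.shift s) (u.shift s) := by
  induction h with
  | refl t => exact .refl _
  | symm _ ih => exact ih.symm
  | trans _ _ ih₁ ih₂ => exact ih₁.trans ih₂
  | pi _ _ ih₁ ih₂ => exact .pi ih₁ ih₂
  | lam _ ih => exact .lam ih
  | app _ _ ih₁ ih₂ => exact .app ih₁ ih₂
  | beta b a =>
    rw [Tm.shift_inst]
    exact .beta _ _
  | eta f =>
    have h := Conv.eta (f.shift s)
    rw [← Tm.shift_rename] at h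
    exact h
  | sigmaInd => exact .sigmaInd ..
  | sumInd_inl => exact .sumInd_inl ..
  | sumInd_inr => exact .sumInd_inr ..
  | unitInd => exact .unitInd ..
  | natInd_zero => exact .natInd_zero ..
  | natInd_succ => exact .natInd_succ ..
  | idInd => exact .idInd ..
  | truncRec => exact .truncRec ..

theorem HasType.cumul_le {Γ : List Tm} {A : Tm} {i j : ℕ} (hij : i ≤ j)
    (h : HasType Γ A (.univ i)) : HasType Γ A (.univ j) := by
  induction hij with
  | refl => exact h
  | step _ ih => exact ih.cumul

/-- Constants are typically ambiguous, so shifting a type amounts to choosing higher levels. The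
exceptions are `empty`, `unit` and `nat`, which are declared in `U 0` only and need cumulativity. -/
theorem HasType.const_shift (s : ℕ) (Γ : List Tm) (c : Const) (k l : ℕ) :
    HasType Γ (.const (c.shift s)) ((c.type k l 0).shift s) := by
  have h := HasType.const Γ (c.shift s) (s + k) (s + l)
  cases c
  case empty => exact h.cumul_le (Nat.zero_le _)
  case unit => exact h.cumul_le (Nat.zero_le _)
  case nat => exact h.cumul_le (Nat.zero_le _)
  all_goals exact h

/-- Raising all universe levels preserves derivability. -/
theorem HasType.shift (s : ℕ) {Γ : List Tm} {t A : Tm} (h : HasType Γ t A) :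
    HasType (Γ.map (Tm.shift s)) (t.shift s) (A.shift s) := by
  induction h with
  | @var Γ n A h =>
    rw [Tm.shift_rename]
    exact .var (by rw [List.getElem?_map, h, Option.map_some])
  | univ Γ k => exact .univ _ _
  | cumul _ ih => exact ih.cumul
  | pi _ _ ih₁ ih₂ => exact .pi ih₁ ih₂
  | lam _ _ ih₁ ih₂ => exact .lam ih₁ ih₂
  | app _ _ ih₁ ih₂ =>
    rw [Tm.shift_inst]
    exact .app ih₁ ih₂
  | const Γ c k l => exact HasType.const_shift s _ c k l
  | conv _ h _ ih₁ ih₂ => exact .conv ih₁ (h.shift s) ih₂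

/-! ### Annotated terms -/

/-- Raw terms in which `λ` records the type of its variable and constants record their levels. -/
inductive ATm : Type
  | var (n : ℕ)
  | univ (k : ℕ)
  | pi (A B : ATm)
  | lam (A b : ATm)
  | app (f a : ATm)
  | const (c : Const) (k l : ℕ)

namespace ATm

/-- Forgets the annotations. -/
def erase : ATm → Tm
  | var n => .var n
  | univ k => .univ k
  | pi A B => .pi A.erase B.erase
  | lam _ b => .lam b.erase
  | app f a => .app f.erase a.erase
  | const c _ _ => .const c

/-- Renaming of variables. -/
def rename : (ℕ → ℕ) → ATm → ATm
  | ρ, var n => var (ρ n)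
  | _, univ k => univ k
  | ρ, pi A B => pi (rename ρ A) (rename (Tm.upRen ρ) B)
  | ρ, lam A b => lam (rename ρ A) (rename (Tm.upRen ρ) b)
  | ρ, app f a => app (rename ρ f) (rename ρ a)
  | _, const c k l => const c k l

/-- The substitution under a binder. -/
def upSubst (σ : ℕ → ATm) : ℕ → ATm
  | 0 => var 0
  | n + 1 => rename Nat.succ (σ n)

/-- Simultaneous capture-avoiding substitution. -/
def subst : (ℕ → ATm) → ATm → ATm
  | σ, var n => σ n
  | _, univ k => univ k
  | σ, pi A B => pi (subst σ A) (subst (upSubst σ) B)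
  | σ, lam A b => lam (subst σ A) (subst (upSubst σ) b)
  | σ, app f a => app (subst σ f) (subst σ a)
  | _, const c k l => const c k l

/-- The substitution of `a` for the variable with index `0`. -/
def single (a : ATm) : ℕ → ATm
  | 0 => a
  | n + 1 => var n

/-- `b[a/x]`, where `x` is the variable with index `0`. -/
def inst (b a : ATm) : ATm := subst (single a) b

theorem erase_rename (ρ : ℕ → ℕ) (t : ATm) : (t.rename ρ).erase = t.erase.rename ρ := by
  induction t generalizing ρ with
  | var n => rfl
  | univ k => rfl
  | const c k l => rfl
  | app f a hf ha => simp only [rename, erase, Tm.rename, hf, ha]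
  | pi A B hA hB => simp only [rename, erase, Tm.rename, hA, hB]
  | lam A b hA hb => simp only [rename, erase, Tm.rename, hb]

theorem erase_subst (σ : ℕ → ATm) (t : ATm) :
    (t.subst σ).erase = t.erase.subst fun n => (σ n).erase := by
  have up (σ : ℕ → ATm) :
      (fun n => (upSubst σ n).erase) = Tm.upSubst fun n => (σ n).erase := by
    funext n
    cases n with
    | zero => rfl
    | succ n => exact erase_rename Nat.succ (σ n)
  induction t generalizing σ with
  | var n => rfl
  | univ k => rfl
  | const c k l => rfl
  | app f a hf ha => simp only [subst, erase, Tm.subst, hf, ha]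
  | pi A B hA hB => simp only [subst, erase, Tm.subst, hA, hB, up]
  | lam A b hA hb => simp only [subst, erase, Tm.subst, hb, up]

theorem erase_inst (b a : ATm) : (b.inst a).erase = b.erase.inst a.erase := by
  rw [inst, Tm.inst, erase_subst]
  congr 1
  funext n
  cases n <;> rfl

/-! ### Normalization -/

/-- The contractum of the application `f ⋄ a`, if that is a `β`-redex or a redex of the
eliminator of `Σ`. -/
def contract : ATm → ATm → Option ATm
  | lam _ b, a => some (b.inst a)
  | app (app (app (app (const .sigmaInd _ _) _) _) _) g,
    app (app (app (app (const .pair _ _) _) _) a) b => some (app (app g a) b)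
  | _, _ => none

theorem conv_contract {f a t : ATm} (h : contract f a = some t) :
    Conv (app f a).erase t.erase := by
  unfold contract at h
  split at h
  · cases h
    rw [erase_inst]
    exact .beta _ _
  · cases h
    exact .sigmaInd ..
  · cases h

/-- Normalization with bounded recursion depth. -/
def nf : ℕ → ATm → ATm
  | 0, t => t
  | _ + 1, var i => var i
  | _ + 1, univ k => univ k
  | _ + 1, const c k l => const c k l
  | n + 1, pi A B => pi (nf n A) (nf n B)
  -- The annotation disappears under `erase`, so it need not be normalized.
  | n + 1, lam A b => lam A (nf n b)
  | n + 1, app f a => match contract (nf n f) (nf n a) with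
    | some t => nf n t
    | none => app (nf n f) (nf n a)

/-- Nothing is claimed about normal forms: every reduction step is a conversion, so the result is
sound even when the depth runs out. -/
theorem conv_nf (n : ℕ) (t : ATm) : Conv t.erase (nf n t).erase := by
  induction n generalizing t with
  | zero => exact .refl _
  | succ n ih =>
    cases t with
    | var i => exact .refl _
    | univ k => exact .refl _
    | const c k l => exact .refl _
    | pi A B => exact .pi (ih A) (ih B)
    | lam A b => exact .lam (ih b)
    | app f a =>
      have happ : Conv (app f a).erase (app (nf n f) (nf n a)).erase := .app (ih f) (ih a)
      rw [nf]
      split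
      · rename_i t ht
        exact happ.trans ((conv_contract ht).trans (ih t))
      · exact happ

end ATm

/-! ### Writing annotated terms with named variables -/

/-- An annotated term as a function of the number of binders above it. -/
abbrev ATerm : Type := ℕ → ATm

namespace ATerm

/-- The universe `U k`. -/
def U (k : ℕ) : ATerm := fun _ => .univ k

/-- A primitive constant at levels `k` and `l`. -/
def cst (c : Const) (k l : ℕ) : ATerm := fun _ => .const c k l

/-- Application. -/
def ap (f a : ATerm) : ATerm := fun d => .app (f d) (a d)

infixl:80 " ⬝ₐ " => ATerm.ap

/-- The variable bound at depth `d`. -/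
def bvar (d : ℕ) : ATerm := fun e => .var (e - (d + 1))

/-- `Π (x : A), B x`. -/
def Pi (A : ATerm) (B : ATerm → ATerm) : ATerm := fun d => .pi (A d) (B (bvar d) (d + 1))

/-- `λ (x : A), b x`. -/
def Lam (A : ATerm) (b : ATerm → ATerm) : ATerm := fun d => .lam (A d) (b (bvar d) (d + 1))

/-- The type of functions `A → B`. -/
def Arr (A B : ATerm) : ATerm := Pi A fun _ => B

infixr:60 " ⇒ₐ " => ATerm.Arr

/-- `Σ (x : A), B x` in `U k`. -/
def Sig (k : ℕ) (A : ATerm) (B : ATerm → ATerm) : ATerm := cst .sigma k 0 ⬝ₐ A ⬝ₐ Lam A B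

/-- The pair `(a, b) : Σ (x : A), B x`. -/
def Pair (k : ℕ) (A : ATerm) (B : ATerm → ATerm) (a b : ATerm) : ATerm :=
  cst .pair k 0 ⬝ₐ A ⬝ₐ Lam A B ⬝ₐ a ⬝ₐ b

/-- `A × B` in `U k`. -/
def Prod (k : ℕ) (A B : ATerm) : ATerm := Sig k A fun _ => B

/-- The identity type `x =_A y`, for `A : U k`. -/
def Id (k : ℕ) (A x y : ATerm) : ATerm := cst .id k 0 ⬝ₐ A ⬝ₐ x ⬝ₐ y

/-- `refl_x : x =_A x`. -/
def Refl (k : ℕ) (A x : ATerm) : ATerm := cst .refl k 0 ⬝ₐ A ⬝ₐ x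

/-- The propositional truncation of `A : U k`. -/
def Trunc (k : ℕ) (A : ATerm) : ATerm := cst .trunc k 0 ⬝ₐ A

/-- `∃ (x : A), B x`. -/
def Ex (k : ℕ) (A : ATerm) (B : ATerm → ATerm) : ATerm := Trunc k (Sig k A B)

/-- `A` is a (mere) proposition. -/
def IsProp (k : ℕ) (A : ATerm) : ATerm := Pi A fun x => Pi A fun y => Id k A x y

/-- The type of right inverses of `x ↦ f x`. -/
def RightInv (k : ℕ) (A B : ATerm) (f : ATerm → ATerm) : ATerm :=
  Sig k (B ⇒ₐ A) fun g => Pi B fun y => Id k B (f (g ⬝ₐ y)) y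

/-- The type of left inverses of `x ↦ f x`. -/
def LeftInv (k : ℕ) (A B : ATerm) (f : ATerm → ATerm) : ATerm :=
  Sig k (B ⇒ₐ A) fun h => Pi A fun x => Id k A (h ⬝ₐ f x) x

/-- The map `x ↦ f x` from `A` to `B` is an equivalence. -/
def IsEquiv (k : ℕ) (A B : ATerm) (f : ATerm → ATerm) : ATerm :=
  Prod k (RightInv k A B f) (LeftInv k A B f)

/-- The type of equivalences `A ≃ B`. -/
def Equiv (k : ℕ) (A B : ATerm) : ATerm := Sig k (A ⇒ₐ B) fun f => IsEquiv k A B fun x => f ⬝ₐ x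

/-- The equivalence with underlying map `f`, right inverse `g` with homotopy `p`, and left inverse
`h` with homotopy `q`. -/
def mkIsEquiv (k : ℕ) (A B : ATerm) (f : ATerm → ATerm) (g p h q : ATerm) : ATerm :=
  Pair k (RightInv k A B f) (fun _ => LeftInv k A B f)
    (Pair k (B ⇒ₐ A) (fun g => Pi B fun y => Id k B (f (g ⬝ₐ y)) y) g p)
    (Pair k (B ⇒ₐ A) (fun h => Pi A fun x => Id k A (h ⬝ₐ f x) x) h q)

/-- The identity equivalence `A ≃ A`. -/
def idEquiv (k : ℕ) (A : ATerm) : ATerm :=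
  Pair k (A ⇒ₐ A) (fun f => IsEquiv k A A fun x => f ⬝ₐ x) (Lam A fun x => x)
    (Pair k (Sig k (A ⇒ₐ A) fun g => Pi A fun y => Id k A (g ⬝ₐ y) y)
      (fun _ => Sig k (A ⇒ₐ A) fun h => Pi A fun x => Id k A (h ⬝ₐ x) x)
      (Pair k (A ⇒ₐ A) (fun g => Pi A fun y => Id k A (g ⬝ₐ y) y) (Lam A fun x => x)
        (Lam A fun x => Refl k A x))
      (Pair k (A ⇒ₐ A) (fun h => Pi A fun x => Id k A (h ⬝ₐ x) x) (Lam A fun x => x)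
        (Lam A fun x => Refl k A x)))

/-- The canonical map `(A =_{U k} B) → (A ≃ B)`. -/
def idToEquiv (k : ℕ) (A B p : ATerm) : ATerm :=
  cst .idInd (k + 1) k ⬝ₐ U k ⬝ₐ
    (Lam (U k) fun X => Lam (U k) fun Y => Lam (Id (k + 1) (U k) X Y) fun _ => Equiv k X Y) ⬝ₐ
    (Lam (U k) fun X => idEquiv k X) ⬝ₐ A ⬝ₐ B ⬝ₐ p

/-- The canonical map `(f = g) → Π (x : A), f x = g x`. -/
def happly (k : ℕ) (A B f g p : ATerm) : ATerm :=
  cst .idInd k k ⬝ₐ (Pi A fun x => B ⬝ₐ x) ⬝ₐ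
    (Lam (Pi A fun x => B ⬝ₐ x) fun f => Lam (Pi A fun x => B ⬝ₐ x) fun g =>
      Lam (Id k (Pi A fun x => B ⬝ₐ x) f g) fun _ =>
        Pi A fun x => Id k (B ⬝ₐ x) (f ⬝ₐ x) (g ⬝ₐ x)) ⬝ₐ
    (Lam (Pi A fun x => B ⬝ₐ x) fun f => Lam A fun x => Refl k (B ⬝ₐ x) (f ⬝ₐ x)) ⬝ₐ
    f ⬝ₐ g ⬝ₐ p

/-- `Y` is `B`-null. -/
def IsNull (k : ℕ) (A B Y : ATerm) : ATerm :=
  Pi A fun a => IsEquiv k Y (B ⬝ₐ a ⇒ₐ Y) fun y => Lam (B ⬝ₐ a) fun _ => y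

/-- The nullification of `X` at the family `B : A → U k`. -/
def Null (k : ℕ) (A B X : ATerm) : ATerm := cst .null k 0 ⬝ₐ A ⬝ₐ B ⬝ₐ X

/-- The unit `X → Null A B X` of nullification. -/
def nullUnit (k : ℕ) (A B X x : ATerm) : ATerm := cst .nullIn k 0 ⬝ₐ A ⬝ₐ B ⬝ₐ X ⬝ₐ x

/-- Annotated versions of the types of those constants that the type checker knows. -/
def constType (k l : ℕ) : Const → Option ATerm
  | .sigma => some <| Pi (U k) fun A => (A ⇒ₐ U k) ⇒ₐ U k
  | .pair => some <| Pi (U k) fun A => Pi (A ⇒ₐ U k) fun B => Pi A fun a => Pi (B ⬝ₐ a) fun _ =>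
      cst .sigma k 0 ⬝ₐ A ⬝ₐ B
  | .sigmaInd => some <| Pi (U k) fun A => Pi (A ⇒ₐ U k) fun B =>
      Pi (cst .sigma k 0 ⬝ₐ A ⬝ₐ B ⇒ₐ U l) fun C =>
      (Pi A fun a => Pi (B ⬝ₐ a) fun b => C ⬝ₐ (cst .pair k 0 ⬝ₐ A ⬝ₐ B ⬝ₐ a ⬝ₐ b)) ⇒ₐ
      Pi (cst .sigma k 0 ⬝ₐ A ⬝ₐ B) fun z => C ⬝ₐ z
  | .unit => some <| U 0
  | .id => some <| Pi (U k) fun A => A ⇒ₐ A ⇒ₐ U k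
  | .refl => some <| Pi (U k) fun A => Pi A fun x => Id k A x x
  | .idInd => some <| Pi (U k) fun A => Pi (Pi A fun x => Pi A fun y => Id k A x y ⇒ₐ U l) fun C =>
      (Pi A fun x => C ⬝ₐ x ⬝ₐ x ⬝ₐ Refl k A x) ⇒ₐ
      Pi A fun x => Pi A fun y => Pi (Id k A x y) fun p => C ⬝ₐ x ⬝ₐ y ⬝ₐ p
  | .funext => some <| Pi (U k) fun A => Pi (A ⇒ₐ U k) fun B =>
      Pi (Pi A fun x => B ⬝ₐ x) fun f => Pi (Pi A fun x => B ⬝ₐ x) fun g =>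
      IsEquiv k (Id k (Pi A fun x => B ⬝ₐ x) f g)
        (Pi A fun x => Id k (B ⬝ₐ x) (f ⬝ₐ x) (g ⬝ₐ x)) fun p => happly k A B f g p
  | .univalence j => some <| Pi (U j) fun A => Pi (U j) fun B =>
      IsEquiv (j + 1) (Id (j + 1) (U j) A B) (Equiv j A B) fun p => idToEquiv j A B p
  | .trunc => some <| U k ⇒ₐ U k
  | .truncIn => some <| Pi (U k) fun A => A ⇒ₐ Trunc k A
  | .truncEq => some <| Pi (U k) fun A => IsProp k (Trunc k A)
  | .truncRec => some <| Pi (U k) fun A => Pi (U l) fun B =>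
      IsProp l B ⇒ₐ (A ⇒ₐ B) ⇒ₐ Trunc k A ⇒ₐ B
  | .null => some <| Pi (U k) fun A => (A ⇒ₐ U k) ⇒ₐ U k ⇒ₐ U k
  | .nullIn => some <| Pi (U k) fun A => Pi (A ⇒ₐ U k) fun B => Pi (U k) fun X =>
      X ⇒ₐ Null k A B X
  | .nullIsNull => some <| Pi (U k) fun A => Pi (A ⇒ₐ U k) fun B => Pi (U k) fun X =>
      IsNull k A B (Null k A B X)
  | .nullRec => some <| Pi (U k) fun A => Pi (A ⇒ₐ U k) fun B => Pi (U k) fun X =>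
      Pi (U k) fun Y => IsNull k A B Y ⇒ₐ
      IsEquiv k (Null k A B X ⇒ₐ Y) (X ⇒ₐ Y) fun f => Lam X fun x => f ⬝ₐ nullUnit k A B X x
  | _ => none

/-- This ties the annotated notation to the official types of the constants; the two agree by
computation. -/
theorem erase_constType {k l : ℕ} {c : Const} {A : ATerm} (h : constType k l c = some A) :
    (A 0).erase = c.type k l 0 := by
  cases c <;> cases h <;> rfl

end ATerm

/-! ### The type checker -/

namespace ATm

/-- The recursion depth of normalization in the type checker. -/
def nfDepth : ℕ := 1000

/-- The level of the type `A`, computed with the inference function `inf`. -/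
def sortWith (inf : List ATm → ATm → Option ATm) (Γ : List ATm) (A : ATm) : Option ℕ :=
  (inf Γ A).bind fun S => match nf nfDepth S with
    | univ i => some i
    | _ => none

/-- Terms of type `A` have type `B` too, by conversion or cumulativity. -/
def subtypeWith (inf : List ATm → ATm → Option ATm) (Γ : List ATm) (A B : ATm) : Bool :=
  if A.erase = B.erase then true
  -- The conversion rule demands that the target is a type. Comparing erasures ignores annotations
  -- and constant levels.
  else (sortWith inf Γ B).isSome && match nf nfDepth A, nf nfDepth B with
    | univ i, univ j => decide (i ≤ j)
    | A', B' => decide (A'.erase = B'.erase)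

/-- `t` has type `A`; this looks under the abstractions at the front of `t`. -/
def checkWith (inf : List ATm → ATm → Option ATm) : List ATm → ATm → ATm → Bool
  | Γ, lam _ b, pi A B => (sortWith inf Γ A).isSome && checkWith inf (A :: Γ) b B
  | Γ, lam _ b, T => match nf nfDepth T with
    -- The sort of `T` is needed for the conversion rule and that of `A` for the `λ` rule; checking
    -- both avoids an inversion lemma for `Π`.
    | pi A B => (sortWith inf Γ T).isSome && ((sortWith inf Γ A).isSome &&
        checkWith inf (A :: Γ) b B)
    | _ => false
  | Γ, t, T => match inf Γ t with
    | some A => subtypeWith inf Γ A T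
    | none => false

/-- The domain and the codomain of the function type `F`. -/
def asPiWith (inf : List ATm → ATm → Option ATm) (Γ : List ATm) : ATm → Option (ATm × ATm)
  | pi A B => some (A, B)
  | F => match nf nfDepth F with
    | pi A B => if (sortWith inf Γ (pi A B)).isSome then some (A, B) else none
    | _ => none

/-- Type inference with bounded recursion depth. -/
def infer : ℕ → List ATm → ATm → Option ATm
  | 0, _, _ => none
  | _ + 1, Γ, var i => Γ[i]?.map (rename fun m => m + (i + 1))
  | _ + 1, _, univ k => some (univ (k + 1))
  | n + 1, Γ, pi A B => match sortWith (infer n) Γ A, sortWith (infer n) (A :: Γ) B with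
    | some i, some j => some (univ (max i j))
    | _, _ => none
  | n + 1, Γ, lam A b => match sortWith (infer n) Γ A, infer n (A :: Γ) b with
    | some _, some B => some (pi A B)
    | _, _ => none
  | n + 1, Γ, app f a => match (infer n Γ f).bind (asPiWith (infer n) Γ) with
    | some (A, B) => if checkWith (infer n) Γ a A then some (B.inst a) else none
    | none => none
  | _ + 1, _, const c k l => (ATerm.constType k l c).map fun A => A 0

/-- All types computed by `inf` are correct. -/
def IsSound (inf : List ATm → ATm → Option ATm) : Prop :=
  ∀ Γ t A, inf Γ t = some A → HasType (Γ.map erase) t.erase A.erase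

section Soundness

variable {inf : List ATm → ATm → Option ATm}

theorem IsSound.sort (h : IsSound inf) {Γ : List ATm} {A : ATm} {i : ℕ}
    (hA : sortWith inf Γ A = some i) : HasType (Γ.map erase) A.erase (.univ i) := by
  obtain ⟨S, hS, hi⟩ := Option.bind_eq_some_iff.1 hA
  have hc := conv_nf nfDepth S
  split at hi
  · rename_i j hj
    cases hi
    rw [hj] at hc
    exact (h _ _ _ hS).conv hc (.univ _ _)
  · cases hi

theorem IsSound.sort_isSome (h : IsSound inf) {Γ : List ATm} {A : ATm}
    (hA : (sortWith inf Γ A).isSome) : ∃ i, HasType (Γ.map erase) A.erase (.univ i) := by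
  obtain ⟨i, hi⟩ := Option.isSome_iff_exists.1 hA
  exact ⟨i, h.sort hi⟩

theorem IsSound.subtype (h : IsSound inf) {Γ : List ATm} {t : Tm} {A B : ATm}
    (ht : HasType (Γ.map erase) t A.erase) (hAB : subtypeWith inf Γ A B) :
    HasType (Γ.map erase) t B.erase := by
  unfold subtypeWith at hAB
  split at hAB
  · rename_i e
    exact e ▸ ht
  · obtain ⟨hB, hAB⟩ := (Bool.and_eq_true _ _).mp hAB
    obtain ⟨k, hB⟩ := h.sort_isSome hB
    have cA := conv_nf nfDepth A
    have cB := conv_nf nfDepth B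
    split at hAB
    · rename_i i j hi hj
      rw [hi] at cA
      rw [hj] at cB
      exact ((ht.conv cA (.univ _ _)).cumul_le (of_decide_eq_true hAB)).conv cB.symm hB
    · rw [of_decide_eq_true hAB] at cA
      exact ht.conv (cA.trans cB.symm) hB

theorem IsSound.check (h : IsSound inf) {Γ : List ATm} {t A : ATm}
    (ht : checkWith inf Γ t A) : HasType (Γ.map erase) t.erase A.erase := by
  fun_induction checkWith inf Γ t A with
  | case1 Γ D b A B ih =>
    obtain ⟨hA, hb⟩ := (Bool.and_eq_true _ _).mp ht
    obtain ⟨i, hA⟩ := h.sort_isSome hA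
    exact .lam hA (ih hb)
  | case2 Γ D b T _ A B hT ih =>
    obtain ⟨hs, ht⟩ := (Bool.and_eq_true _ _).mp ht
    obtain ⟨hA, hb⟩ := (Bool.and_eq_true _ _).mp ht
    obtain ⟨i, hA⟩ := h.sort_isSome hA
    obtain ⟨j, hs⟩ := h.sort_isSome hs
    have hc := conv_nf nfDepth T
    rw [hT] at hc
    exact (HasType.lam hA (ih hb)).conv hc.symm hs
  | case3 => cases ht
  | case4 Γ t T _ _ A hA => exact h.subtype (h _ _ _ hA) ht
  | case5 => cases ht

theorem IsSound.asPi (h : IsSound inf) {Γ : List ATm} {t : Tm} {F A B : ATm}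
    (ht : HasType (Γ.map erase) t F.erase) (hF : asPiWith inf Γ F = some (A, B)) :
    HasType (Γ.map erase) t (.pi A.erase B.erase) := by
  unfold asPiWith at hF
  split at hF
  · cases hF
    exact ht
  · split at hF
    · rename_i A' B' hF'
      split at hF
      · rename_i hs
        cases hF
        obtain ⟨i, hs⟩ := h.sort_isSome hs
        have hc := conv_nf nfDepth F
        rw [hF'] at hc
        exact ht.conv hc hs
      · cases hF
    · cases hF

end Soundness

/-- The auxiliary functions take the inference function as a parameter, so soundness at depth `n`
gives their soundness, and hence soundness at depth `n + 1`. -/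
theorem isSound_infer (n : ℕ) : IsSound (infer n) := by
  induction n with
  | zero => intro Γ t A h; cases h
  | succ n ih =>
    intro Γ t A h
    cases t with
    | var i =>
      obtain ⟨B, hB, rfl⟩ := Option.map_eq_some_iff.1 h
      rw [erase_rename]
      exact .var (by rw [List.getElem?_map, hB, Option.map_some])
    | univ k =>
      cases h
      exact .univ _ _
    | pi A B =>
      rw [infer] at h
      split at h
      · rename_i i j hi hj
        cases h
        -- The `Π` rule wants one common level, reached by cumulativity.
        exact .pi ((ih.sort hi).cumul_le (le_max_left _ _))
          ((ih.sort hj).cumul_le (le_max_right _ _))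
      · cases h
    | lam A b =>
      rw [infer] at h
      split at h
      · rename_i i B hi hB
        cases h
        exact .lam (ih.sort hi) (ih _ _ _ hB)
      · cases h
    | app f a =>
      rw [infer] at h
      split at h
      · rename_i A B hf
        split at h
        · rename_i ha
          cases h
          obtain ⟨F, hF, hAB⟩ := Option.bind_eq_some_iff.1 hf
          rw [erase_inst]
          exact .app (ih.asPi (ih _ _ _ hF) hAB) (ih.check ha)
        · cases h
      · cases h
    | const c k l =>
      obtain ⟨B, hB, rfl⟩ := Option.map_eq_some_iff.1 h
      rw [ATerm.erase_constType hB]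
      exact .const _ _ _ _

end ATm

namespace ATerm

/-- The closed type `A` is inhabited. -/
def Inhabited (A : ATerm) : Prop := ∃ t : Tm, HasType [] t (A 0).erase

/-- The type checker accepts the closed term `t` as a term of type `A`. -/
def checks (t A : ATerm) : Bool := ATm.checkWith (ATm.infer 200) [] (t 0) (A 0)

theorem Inhabited.of_checks {A : ATerm} (t : ATerm) (h : checks t A = true) : A.Inhabited :=
  ⟨(t 0).erase, (ATm.isSound_infer 200).check h⟩

/-- Allows each result to be checked with its predecessors as variables, so that their proofs are
not inlined. The hypothesis `hB` says that `B` under one binder is its weakening, as holds for every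
closed type. -/
theorem Inhabited.mp {A B : ATerm} (hB : (B 1).erase = (B 0).erase.rename Nat.succ)
    (hf : (A ⇒ₐ B).Inhabited) (hA : A.Inhabited) : B.Inhabited := by
  obtain ⟨f, hf⟩ := hf
  obtain ⟨a, ha⟩ := hA
  have h := hf.app ha
  rw [hB, Tm.inst_rename_succ] at h
  exact ⟨_, h⟩

/-! ### Derived constructions -/

/-- The non-dependent eliminator of `Σ (x : A), B x` in `U k`, into `C : U l`. -/
def sigRec (k l : ℕ) (A : ATerm) (B : ATerm → ATerm) (C : ATerm) (f : ATerm → ATerm → ATerm)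
    (z : ATerm) : ATerm :=
  cst .sigmaInd k l ⬝ₐ A ⬝ₐ Lam A B ⬝ₐ (Lam (Sig k A B) fun _ => C) ⬝ₐ
    (Lam A fun a => Lam (B a) fun b => f a b) ⬝ₐ z

/-- The first projection. -/
def fst (k : ℕ) (A : ATerm) (B : ATerm → ATerm) (z : ATerm) : ATerm :=
  sigRec k k A B A (fun a _ => a) z

/-- The second projection. -/
def snd (k : ℕ) (A : ATerm) (B : ATerm → ATerm) (z : ATerm) : ATerm :=
  cst .sigmaInd k k ⬝ₐ A ⬝ₐ Lam A B ⬝ₐ (Lam (Sig k A B) fun z => B (fst k A B z)) ⬝ₐ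
    (Lam A fun a => Lam (B a) fun b => b) ⬝ₐ z

/-- The right inverse of the equivalence `x ↦ f x`. -/
def rightInv (k : ℕ) (A B : ATerm) (f : ATerm → ATerm) (e : ATerm) : ATerm :=
  fst k (B ⇒ₐ A) (fun g => Pi B fun y => Id k B (f (g ⬝ₐ y)) y)
    (fst k (RightInv k A B f) (fun _ => LeftInv k A B f) e)

/-- The left inverse of the equivalence `x ↦ f x`. -/
def leftInv (k : ℕ) (A B : ATerm) (f : ATerm → ATerm) (e : ATerm) : ATerm :=
  fst k (B ⇒ₐ A) (fun h => Pi A fun x => Id k A (h ⬝ₐ f x) x)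
    (snd k (RightInv k A B f) (fun _ => LeftInv k A B f) e)

/-- The homotopy that belongs to `leftInv`. -/
def leftInvEq (k : ℕ) (A B : ATerm) (f : ATerm → ATerm) (e : ATerm) : ATerm :=
  snd k (B ⇒ₐ A) (fun h => Pi A fun x => Id k A (h ⬝ₐ f x) x)
    (snd k (RightInv k A B f) (fun _ => LeftInv k A B f) e)

/-- `a : A` as an element of `‖A‖`. -/
def truncIn (k : ℕ) (A a : ATerm) : ATerm := cst .truncIn k 0 ⬝ₐ A ⬝ₐ a

/-- The eliminator of `‖A‖` into a proposition `B : U l`. -/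
def truncRec (k l : ℕ) (A B h : ATerm) (f : ATerm → ATerm) (z : ATerm) : ATerm :=
  cst .truncRec k l ⬝ₐ A ⬝ₐ B ⬝ₐ h ⬝ₐ (Lam A fun a => f a) ⬝ₐ z

/-- The witness `(a, b)` of `∃ (x : A), B x`. -/
def exIntro (k : ℕ) (A : ATerm) (B : ATerm → ATerm) (a b : ATerm) : ATerm :=
  truncIn k (Sig k A B) (Pair k A B a b)

/-- The proof that `∃ (x : A), B x` is a proposition. -/
def exProp (k : ℕ) (A : ATerm) (B : ATerm → ATerm) : ATerm := cst .truncEq k 0 ⬝ₐ Sig k A B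

/-- The eliminator of `∃ (x : A), B x` into a proposition `C : U l`. -/
def exRec (k l : ℕ) (A : ATerm) (B : ATerm → ATerm) (C h : ATerm) (f : ATerm → ATerm → ATerm)
    (z : ATerm) : ATerm :=
  truncRec k l (Sig k A B) C h (fun w => sigRec k l A B C f w) z

/-! ### Identity types and propositions -/

/-- Equal types in `U 0` have maps between them. -/
def Coe : ATerm := Pi (U 0) fun A => Pi (U 0) fun B => Id 1 (U 0) A B ⇒ₐ A ⇒ₐ B

theorem coe_inhabited : Coe.Inhabited :=
  .of_checks (Lam (U 0) fun A => Lam (U 0) fun B =>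
    cst .idInd 1 0 ⬝ₐ U 0 ⬝ₐ
      (Lam (U 0) fun X => Lam (U 0) fun Y => Lam (Id 1 (U 0) X Y) fun _ => X ⇒ₐ Y) ⬝ₐ
      (Lam (U 0) fun X => Lam X fun x => x) ⬝ₐ A ⬝ₐ B) (by decide +kernel)

/-- Functions preserve equality. -/
def Congr : ATerm :=
  Pi (U 0) fun A => Pi (U 0) fun B => Pi (A ⇒ₐ B) fun h => Pi A fun x => Pi A fun y =>
    Id 0 A x y ⇒ₐ Id 0 B (h ⬝ₐ x) (h ⬝ₐ y)

theorem congr_inhabited : Congr.Inhabited :=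
  .of_checks (Lam (U 0) fun A => Lam (U 0) fun B => Lam (A ⇒ₐ B) fun h =>
    cst .idInd 0 0 ⬝ₐ A ⬝ₐ
      (Lam A fun x => Lam A fun y => Lam (Id 0 A x y) fun _ => Id 0 B (h ⬝ₐ x) (h ⬝ₐ y)) ⬝ₐ
      (Lam A fun x => Refl 0 B (h ⬝ₐ x))) (by decide +kernel)

/-- Equality is Euclidean. -/
def Eucl : ATerm :=
  Pi (U 0) fun A => Pi A fun x => Pi A fun y => Id 0 A x y ⇒ₐ
    Pi A fun z => Id 0 A x z ⇒ₐ Id 0 A y z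

theorem eucl_inhabited : Eucl.Inhabited :=
  .of_checks (Lam (U 0) fun A => cst .idInd 0 0 ⬝ₐ A ⬝ₐ
    (Lam A fun x => Lam A fun y => Lam (Id 0 A x y) fun _ =>
      Pi A fun z => Id 0 A x z ⇒ₐ Id 0 A y z) ⬝ₐ
    (Lam A fun x => Lam A fun z => Lam (Id 0 A x z) fun q => q)) (by decide +kernel)

/-- Equal functions are pointwise equal. -/
def CongrFun : ATerm :=
  Pi (U 0) fun A => Pi (U 0) fun B => Pi (A ⇒ₐ B) fun f => Pi (A ⇒ₐ B) fun g =>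
    Id 0 (A ⇒ₐ B) f g ⇒ₐ Pi A fun x => Id 0 B (f ⬝ₐ x) (g ⬝ₐ x)

theorem congrFun_inhabited : CongrFun.Inhabited :=
  .of_checks (Lam (U 0) fun A => Lam (U 0) fun B => cst .idInd 0 0 ⬝ₐ (A ⇒ₐ B) ⬝ₐ
    (Lam (A ⇒ₐ B) fun f => Lam (A ⇒ₐ B) fun g => Lam (Id 0 (A ⇒ₐ B) f g) fun _ =>
      Pi A fun x => Id 0 B (f ⬝ₐ x) (g ⬝ₐ x)) ⬝ₐ
    (Lam (A ⇒ₐ B) fun f => Lam A fun x => Refl 0 B (f ⬝ₐ x))) (by decide +kernel)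

/-- Pointwise equal functions are equal. -/
def FunExt : ATerm :=
  Pi (U 0) fun A => Pi (U 0) fun B => Pi (A ⇒ₐ B) fun f => Pi (A ⇒ₐ B) fun g =>
    (Pi A fun x => Id 0 B (f ⬝ₐ x) (g ⬝ₐ x)) ⇒ₐ Id 0 (A ⇒ₐ B) f g

theorem funExt_inhabited : FunExt.Inhabited :=
  .of_checks (Lam (U 0) fun A => Lam (U 0) fun B => Lam (A ⇒ₐ B) fun f => Lam (A ⇒ₐ B) fun g =>
    rightInv 0 (Id 0 (A ⇒ₐ B) f g) (Pi A fun x => Id 0 B (f ⬝ₐ x) (g ⬝ₐ x))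
      (fun p => happly 0 A (Lam A fun _ => B) f g p)
      (cst .funext 0 0 ⬝ₐ A ⬝ₐ (Lam A fun _ => B) ⬝ₐ f ⬝ₐ g)) (by decide +kernel)

/-- A map with a left inverse is injective. -/
def Injective : ATerm :=
  Pi (U 0) fun A => Pi (U 0) fun B => Pi (A ⇒ₐ B) fun m => Pi (B ⇒ₐ A) fun h =>
    (Pi A fun a => Id 0 A (h ⬝ₐ (m ⬝ₐ a)) a) ⇒ₐ Pi A fun x => Pi A fun y =>
      Id 0 B (m ⬝ₐ x) (m ⬝ₐ y) ⇒ₐ Id 0 A x y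

/-- The chain `x = h (m x) = h (m y) = y`; the Euclidean property supplies both symmetry and
transitivity. -/
theorem injective_inhabited : Injective.Inhabited := by
  have h : (Congr ⇒ₐ Eucl ⇒ₐ Injective).Inhabited :=
    .of_checks (Lam Congr fun congr => Lam Eucl fun eucl =>
      Lam (U 0) fun A => Lam (U 0) fun B => Lam (A ⇒ₐ B) fun m => Lam (B ⇒ₐ A) fun h =>
      Lam (Pi A fun a => Id 0 A (h ⬝ₐ (m ⬝ₐ a)) a) fun hm => Lam A fun x => Lam A fun y =>
      Lam (Id 0 B (m ⬝ₐ x) (m ⬝ₐ y)) fun p =>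
        eucl ⬝ₐ A ⬝ₐ (h ⬝ₐ (m ⬝ₐ y)) ⬝ₐ x ⬝ₐ
          (eucl ⬝ₐ A ⬝ₐ (h ⬝ₐ (m ⬝ₐ x)) ⬝ₐ (h ⬝ₐ (m ⬝ₐ y)) ⬝ₐ
            (congr ⬝ₐ B ⬝ₐ A ⬝ₐ h ⬝ₐ (m ⬝ₐ x) ⬝ₐ (m ⬝ₐ y) ⬝ₐ p) ⬝ₐ x ⬝ₐ (hm ⬝ₐ x)) ⬝ₐ
          y ⬝ₐ (hm ⬝ₐ y)) (by decide +kernel)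
  exact .mp (by decide +kernel) (.mp (by decide +kernel) h congr_inhabited) eucl_inhabited

/-- Functions into a proposition form a proposition. -/
def ArrProp : ATerm := Pi (U 0) fun A => Pi (U 0) fun B => IsProp 0 B ⇒ₐ IsProp 0 (A ⇒ₐ B)

theorem arrProp_inhabited : ArrProp.Inhabited := by
  have h : (FunExt ⇒ₐ ArrProp).Inhabited :=
    .of_checks (Lam FunExt fun funExt => Lam (U 0) fun A => Lam (U 0) fun B =>
      Lam (IsProp 0 B) fun hB => Lam (A ⇒ₐ B) fun f => Lam (A ⇒ₐ B) fun g =>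
        funExt ⬝ₐ A ⬝ₐ B ⬝ₐ f ⬝ₐ g ⬝ₐ (Lam A fun x => hB ⬝ₐ (f ⬝ₐ x) ⬝ₐ (g ⬝ₐ x)))
      (by decide +kernel)
  exact .mp (by decide +kernel) h funExt_inhabited

/-- A map between propositions is an equivalence if there is a map back. -/
def PropEquiv (k : ℕ) : ATerm :=
  Pi (U k) fun X => Pi (U k) fun Y => IsProp k X ⇒ₐ IsProp k Y ⇒ₐ Pi (X ⇒ₐ Y) fun f =>
    (Y ⇒ₐ X) ⇒ₐ IsEquiv k X Y fun x => f ⬝ₐ x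

/-- The proof of `PropEquiv`. -/
def propEquiv (k : ℕ) : ATerm :=
  Lam (U k) fun X => Lam (U k) fun Y => Lam (IsProp k X) fun hX => Lam (IsProp k Y) fun hY =>
    Lam (X ⇒ₐ Y) fun f => Lam (Y ⇒ₐ X) fun g =>
      mkIsEquiv k X Y (fun x => f ⬝ₐ x) g (Lam Y fun y => hY ⬝ₐ (f ⬝ₐ (g ⬝ₐ y)) ⬝ₐ y)
        g (Lam X fun x => hX ⬝ₐ (g ⬝ₐ (f ⬝ₐ x)) ⬝ₐ x)

theorem propEquiv_inhabited : (PropEquiv 0).Inhabited :=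
  .of_checks (propEquiv 0) (by decide +kernel)

theorem propEquiv_inhabited_one : (PropEquiv 1).Inhabited :=
  .of_checks (propEquiv 1) (by decide +kernel)

/-- Propositional extensionality. -/
def PropExt (k : ℕ) : ATerm :=
  Pi (U k) fun X => Pi (U k) fun Y => IsProp k X ⇒ₐ IsProp k Y ⇒ₐ (X ⇒ₐ Y) ⇒ₐ (Y ⇒ₐ X) ⇒ₐ
    Id (k + 1) (U k) X Y

/-- The proof of `PropExt` from `PropEquiv`. -/
def propExt (k : ℕ) : ATerm :=
  Lam (PropEquiv k) fun e => Lam (U k) fun X => Lam (U k) fun Y => Lam (IsProp k X) fun hX =>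
    Lam (IsProp k Y) fun hY => Lam (X ⇒ₐ Y) fun f => Lam (Y ⇒ₐ X) fun g =>
      rightInv (k + 1) (Id (k + 1) (U k) X Y) (Equiv k X Y) (fun p => idToEquiv k X Y p)
        (cst (.univalence k) 0 0 ⬝ₐ X ⬝ₐ Y) ⬝ₐ
        Pair k (X ⇒ₐ Y) (fun f => IsEquiv k X Y fun x => f ⬝ₐ x) f
          (e ⬝ₐ X ⬝ₐ Y ⬝ₐ hX ⬝ₐ hY ⬝ₐ f ⬝ₐ g)

theorem propExt_inhabited : (PropExt 0).Inhabited :=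
  .mp (by decide +kernel) (.of_checks (propExt 0) (by decide +kernel)) propEquiv_inhabited

theorem propExt_inhabited_one : (PropExt 1).Inhabited :=
  .mp (by decide +kernel) (.of_checks (propExt 1) (by decide +kernel)) propEquiv_inhabited_one

/-! ### Nullification of propositions -/

/-- Maps out of a nullification into a null type are equal if they agree on the image of the
unit. -/
def NullExt : ATerm :=
  Pi (U 0) fun A => Pi (A ⇒ₐ U 0) fun B => Pi (U 0) fun X => Pi (U 0) fun Y =>
    IsNull 0 A B Y ⇒ₐ Pi (Null 0 A B X ⇒ₐ Y) fun f => Pi (Null 0 A B X ⇒ₐ Y) fun g =>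
      (Pi X fun x => Id 0 Y (f ⬝ₐ nullUnit 0 A B X x) (g ⬝ₐ nullUnit 0 A B X x)) ⇒ₐ
      Pi (Null 0 A B X) fun z => Id 0 Y (f ⬝ₐ z) (g ⬝ₐ z)

/-- Precomposition with the unit is an equivalence, so its left inverse makes it injective on maps
into a null type. -/
theorem nullExt_inhabited : NullExt.Inhabited := by
  have h : (CongrFun ⇒ₐ FunExt ⇒ₐ Injective ⇒ₐ NullExt).Inhabited :=
    .of_checks (Lam CongrFun fun congrFun => Lam FunExt fun funExt => Lam Injective fun inj =>
      Lam (U 0) fun A => Lam (A ⇒ₐ U 0) fun B => Lam (U 0) fun X => Lam (U 0) fun Y =>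
      Lam (IsNull 0 A B Y) fun hY =>
      Lam (Null 0 A B X ⇒ₐ Y) fun f => Lam (Null 0 A B X ⇒ₐ Y) fun g =>
      Lam (Pi X fun x => Id 0 Y (f ⬝ₐ nullUnit 0 A B X x) (g ⬝ₐ nullUnit 0 A B X x)) fun p =>
        let N := Null 0 A B X
        let m := fun f => Lam X fun x => f ⬝ₐ nullUnit 0 A B X x
        let e := cst .nullRec 0 0 ⬝ₐ A ⬝ₐ B ⬝ₐ X ⬝ₐ Y ⬝ₐ hY
        congrFun ⬝ₐ N ⬝ₐ Y ⬝ₐ f ⬝ₐ g ⬝ₐ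
          (inj ⬝ₐ (N ⇒ₐ Y) ⬝ₐ (X ⇒ₐ Y) ⬝ₐ Lam (N ⇒ₐ Y) m ⬝ₐ
            leftInv 0 (N ⇒ₐ Y) (X ⇒ₐ Y) m e ⬝ₐ leftInvEq 0 (N ⇒ₐ Y) (X ⇒ₐ Y) m e ⬝ₐ f ⬝ₐ g ⬝ₐ
            (funExt ⬝ₐ X ⬝ₐ Y ⬝ₐ m f ⬝ₐ m g ⬝ₐ p))) (by decide +kernel)
  exact .mp (by decide +kernel) (.mp (by decide +kernel) (.mp (by decide +kernel) h
    congrFun_inhabited) funExt_inhabited) injective_inhabited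

/-- The nullification of a proposition is a proposition. -/
def NullProp : ATerm :=
  Pi (U 0) fun A => Pi (A ⇒ₐ U 0) fun B => Pi (U 0) fun X => IsProp 0 X ⇒ₐ
    IsProp 0 (Null 0 A B X)

theorem nullProp_inhabited : NullProp.Inhabited := by
  have h : (Congr ⇒ₐ NullExt ⇒ₐ NullProp).Inhabited :=
    .of_checks (Lam Congr fun congr => Lam NullExt fun nullExt =>
      Lam (U 0) fun A => Lam (A ⇒ₐ U 0) fun B => Lam (U 0) fun X => Lam (IsProp 0 X) fun hX =>
      Lam (Null 0 A B X) fun x => Lam (Null 0 A B X) fun y =>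
        let N := Null 0 A B X
        let η := nullUnit 0 A B X
        let ext := fun f g p z => nullExt ⬝ₐ A ⬝ₐ B ⬝ₐ X ⬝ₐ N ⬝ₐ
          (cst .nullIsNull 0 0 ⬝ₐ A ⬝ₐ B ⬝ₐ X) ⬝ₐ Lam N f ⬝ₐ Lam N g ⬝ₐ Lam X p ⬝ₐ z
        -- Two nested uses of `NullExt`. The outer one reduces `x = y` to `x = η p` for `p : X`, the
        -- inner one reduces that to `η q = η p` for `q : X`, which holds as `X` is a proposition.
        ext (fun _ => x) (fun w => w) (fun p => ext (fun w => w) (fun _ => η p)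
          (fun q => congr ⬝ₐ X ⬝ₐ N ⬝ₐ Lam X η ⬝ₐ q ⬝ₐ p ⬝ₐ (hX ⬝ₐ q ⬝ₐ p)) x) y)
      (by decide +kernel)
  exact .mp (by decide +kernel) (.mp (by decide +kernel) h congr_inhabited) nullExt_inhabited

/-! ### Presentations -/

/-- `X ∈ T`. -/
def Mem (I T X : ATerm) : ATerm := Ex 1 I fun i => Id 1 (U 0) (T ⬝ₐ i) X

/-- `1 ∈ T`. -/
def HasUnit (I T : ATerm) : ATerm := Mem I T (cst .unit 0 0)

/-- `T` is closed under `Σ`. -/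
def HasSigma (I T : ATerm) : ATerm :=
  Pi (U 0) fun X => Pi (X ⇒ₐ U 0) fun B =>
    Mem I T X ⇒ₐ (Pi X fun x => Mem I T (B ⬝ₐ x)) ⇒ₐ Mem I T (Sig 0 X fun x => B ⬝ₐ x)

/-- `T` is a presentation. -/
def IsPresentation (I T : ATerm) : ATerm := Prod 1 (HasUnit I T) (HasSigma I T)

/-- `X` is projective. -/
def IsProjective (X : ATerm) : ATerm :=
  Pi (X ⇒ₐ U 0) fun B => (Pi X fun x => Trunc 0 (B ⬝ₐ x)) ⇒ₐ Trunc 0 (Pi X fun x => B ⬝ₐ x)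

/-- All members of `T` are projective. -/
def AllProjective (I T : ATerm) : ATerm := Pi (U 0) fun X => Mem I T X ⇒ₐ IsProjective X

/-- `T` is a projective presentation. -/
def IsProjectivePresentation (I T : ATerm) : ATerm :=
  Prod 1 (IsPresentation I T) (AllProjective I T)

/-- The family of propositions `‖T i‖`. -/
def truncFam (I T : ATerm) : ATerm := Lam I fun i => Trunc 0 (T ⬝ₐ i)

/-- The `T`-sheafification of `X`. -/
def Sheafification (I T X : ATerm) : ATerm := Null 0 I (truncFam I T) X

/-- The type of pairs of `i : I` and a function `T i → P`. -/
def Cover (I T P : ATerm) : ATerm := Sig 0 I fun i => T ⬝ₐ i ⇒ₐ P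

/-- `∃ (i : I), (T i → P)`. -/
def ExCover (I T P : ATerm) : ATerm := Ex 0 I fun i => T ⬝ₐ i ⇒ₐ P

/-- `∃ (A : U 0), (A ∈ T) × (A → P)`. -/
def ExMemCover (I T P : ATerm) : ATerm := Ex 1 (U 0) fun A => Prod 1 (Mem I T A) (A ⇒ₐ P)

/-- The proof of `T i ∈ T`. -/
def memSelf (I T i : ATerm) : ATerm :=
  exIntro 1 I (fun j => Id 1 (U 0) (T ⬝ₐ j) (T ⬝ₐ i)) i (Refl 1 (U 0) (T ⬝ₐ i))

/-! ### Covers of `P` form a sheaf -/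

/-- `P` implies `∃ (i : I), (T i → P)` if `1 ∈ T`. -/
def UnitCover : ATerm :=
  Pi (U 0) fun I => Pi (I ⇒ₐ U 0) fun T => HasUnit I T ⇒ₐ Pi (U 0) fun P => P ⇒ₐ ExCover I T P

theorem unitCover_inhabited : UnitCover.Inhabited :=
  .of_checks (Lam (U 0) fun I => Lam (I ⇒ₐ U 0) fun T => Lam (HasUnit I T) fun h =>
    Lam (U 0) fun P => Lam P fun x =>
      exRec 1 0 I (fun i => Id 1 (U 0) (T ⬝ₐ i) (cst .unit 0 0)) (ExCover I T P)
        (exProp 0 I fun i => T ⬝ₐ i ⇒ₐ P)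
        (fun i _ => exIntro 0 I (fun i => T ⬝ₐ i ⇒ₐ P) i (Lam (T ⬝ₐ i) fun _ => x)) h)
    (by decide +kernel)

/-- A member of `T` and a map from it to `P` yield `∃ (i : I), (T i → P)`. -/
def MemCover : ATerm :=
  Pi (U 0) fun I => Pi (I ⇒ₐ U 0) fun T => Pi (U 0) fun P => Pi (U 0) fun A =>
    Mem I T A ⇒ₐ (A ⇒ₐ P) ⇒ₐ ExCover I T P

theorem memCover_inhabited : MemCover.Inhabited := by
  have h : (Coe ⇒ₐ MemCover).Inhabited :=
    .of_checks (Lam Coe fun coe => Lam (U 0) fun I => Lam (I ⇒ₐ U 0) fun T => Lam (U 0) fun P =>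
      Lam (U 0) fun A => Lam (Mem I T A) fun hA => Lam (A ⇒ₐ P) fun f =>
        exRec 1 0 I (fun i => Id 1 (U 0) (T ⬝ₐ i) A) (ExCover I T P)
          (exProp 0 I fun i => T ⬝ₐ i ⇒ₐ P)
          (fun i p => exIntro 0 I (fun i => T ⬝ₐ i ⇒ₐ P) i
            (Lam (T ⬝ₐ i) fun t => f ⬝ₐ (coe ⬝ₐ (T ⬝ₐ i) ⬝ₐ A ⬝ₐ p ⬝ₐ t))) hA)
      (by decide +kernel)
  exact .mp (by decide +kernel) h coe_inhabited

/-- A family over `T i` of maps from members of `T` to `P` yields `∃ (i : I), (T i → P)`, as `T` is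
closed under `Σ`. -/
def SigmaCover : ATerm :=
  Pi (U 0) fun I => Pi (I ⇒ₐ U 0) fun T => HasSigma I T ⇒ₐ Pi (U 0) fun P => Pi I fun i =>
    (T ⬝ₐ i ⇒ₐ Cover I T P) ⇒ₐ ExCover I T P

/-- The sum over `t : T i` of the chosen members maps to `P` by uncurrying. Closure under `Σ` makes
it only merely equal to some `T j`, hence the detour through `MemCover`. -/
theorem sigmaCover_inhabited : SigmaCover.Inhabited := by
  have h : (MemCover ⇒ₐ SigmaCover).Inhabited :=
    .of_checks (Lam MemCover fun memCover => Lam (U 0) fun I => Lam (I ⇒ₐ U 0) fun T =>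
      Lam (HasSigma I T) fun hT => Lam (U 0) fun P => Lam I fun i =>
      Lam (T ⬝ₐ i ⇒ₐ Cover I T P) fun g =>
        let idx := fun t => fst 0 I (fun i => T ⬝ₐ i ⇒ₐ P) (g ⬝ₐ t)
        memCover ⬝ₐ I ⬝ₐ T ⬝ₐ P ⬝ₐ (Sig 0 (T ⬝ₐ i) fun t => T ⬝ₐ idx t) ⬝ₐ
          (hT ⬝ₐ (T ⬝ₐ i) ⬝ₐ (Lam (T ⬝ₐ i) fun t => T ⬝ₐ idx t) ⬝ₐ memSelf I T i ⬝ₐ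
            (Lam (T ⬝ₐ i) fun t => memSelf I T (idx t))) ⬝ₐ
          (Lam (Sig 0 (T ⬝ₐ i) fun t => T ⬝ₐ idx t) fun w =>
            sigRec 0 0 (T ⬝ₐ i) (fun t => T ⬝ₐ idx t) P
              (fun t u => snd 0 I (fun i => T ⬝ₐ i ⇒ₐ P) (g ⬝ₐ t) ⬝ₐ u) w))
      (by decide +kernel)
  exact .mp (by decide +kernel) h memCover_inhabited

/-- For a projective presentation, `∃ (i : I), (T i → P)` can be proved locally. -/
def LocalCover : ATerm :=
  Pi (U 0) fun I => Pi (I ⇒ₐ U 0) fun T => HasSigma I T ⇒ₐ AllProjective I T ⇒ₐ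
    Pi (U 0) fun P => Pi I fun i => (Trunc 0 (T ⬝ₐ i) ⇒ₐ ExCover I T P) ⇒ₐ ExCover I T P

theorem localCover_inhabited : LocalCover.Inhabited := by
  have h : (SigmaCover ⇒ₐ LocalCover).Inhabited :=
    .of_checks (Lam SigmaCover fun sigmaCover => Lam (U 0) fun I => Lam (I ⇒ₐ U 0) fun T =>
      Lam (HasSigma I T) fun hT => Lam (AllProjective I T) fun hproj => Lam (U 0) fun P =>
      Lam I fun i => Lam (Trunc 0 (T ⬝ₐ i) ⇒ₐ ExCover I T P) fun f =>
        truncRec 0 0 (T ⬝ₐ i ⇒ₐ Cover I T P) (ExCover I T P) (exProp 0 I fun i => T ⬝ₐ i ⇒ₐ P)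
          (fun g => sigmaCover ⬝ₐ I ⬝ₐ T ⬝ₐ hT ⬝ₐ P ⬝ₐ i ⬝ₐ g)
          -- Projectivity for the constant family `Cover I T P`, whose truncation is `ExCover I T
          -- P`.
          (hproj ⬝ₐ (T ⬝ₐ i) ⬝ₐ memSelf I T i ⬝ₐ (Lam (T ⬝ₐ i) fun _ => Cover I T P) ⬝ₐ
            (Lam (T ⬝ₐ i) fun t => f ⬝ₐ truncIn 0 (T ⬝ₐ i) t))) (by decide +kernel)
  exact .mp (by decide +kernel) h sigmaCover_inhabited

/-- For a projective presentation, `∃ (i : I), (T i → P)` is a `T`-sheaf. -/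
def CoverSheaf : ATerm :=
  Pi (U 0) fun I => Pi (I ⇒ₐ U 0) fun T => HasSigma I T ⇒ₐ AllProjective I T ⇒ₐ
    Pi (U 0) fun P => IsNull 0 I (truncFam I T) (ExCover I T P)

theorem coverSheaf_inhabited : CoverSheaf.Inhabited := by
  have h : (ArrProp ⇒ₐ PropEquiv 0 ⇒ₐ LocalCover ⇒ₐ CoverSheaf).Inhabited :=
    .of_checks (Lam ArrProp fun arrProp => Lam (PropEquiv 0) fun propEquiv =>
      Lam LocalCover fun localCover => Lam (U 0) fun I => Lam (I ⇒ₐ U 0) fun T =>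
      Lam (HasSigma I T) fun hT => Lam (AllProjective I T) fun hproj => Lam (U 0) fun P =>
      Lam I fun i =>
        let Q := ExCover I T P
        let hQ := exProp 0 I fun i => T ⬝ₐ i ⇒ₐ P
        let X := Trunc 0 (T ⬝ₐ i)
        propEquiv ⬝ₐ Q ⬝ₐ (X ⇒ₐ Q) ⬝ₐ hQ ⬝ₐ (arrProp ⬝ₐ X ⬝ₐ Q ⬝ₐ hQ) ⬝ₐ
          (Lam Q fun y => Lam X fun _ => y) ⬝ₐ
          (localCover ⬝ₐ I ⬝ₐ T ⬝ₐ hT ⬝ₐ hproj ⬝ₐ P ⬝ₐ i)) (by decide +kernel)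
  exact .mp (by decide +kernel) (.mp (by decide +kernel) (.mp (by decide +kernel) h
    arrProp_inhabited) propEquiv_inhabited) localCover_inhabited

/-! ### Comparison of covers with the sheafification -/

/-- The sheafification of `P` implies `∃ (i : I), (T i → P)`. -/
def SheafToCover : ATerm :=
  Pi (U 0) fun I => Pi (I ⇒ₐ U 0) fun T => HasUnit I T ⇒ₐ HasSigma I T ⇒ₐ AllProjective I T ⇒ₐ
    Pi (U 0) fun P => Sheafification I T P ⇒ₐ ExCover I T P

theorem sheafToCover_inhabited : SheafToCover.Inhabited := by
  have h : (UnitCover ⇒ₐ CoverSheaf ⇒ₐ SheafToCover).Inhabited :=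
    .of_checks (Lam UnitCover fun unitCover => Lam CoverSheaf fun coverSheaf =>
      Lam (U 0) fun I => Lam (I ⇒ₐ U 0) fun T => Lam (HasUnit I T) fun hunit =>
      Lam (HasSigma I T) fun hT => Lam (AllProjective I T) fun hproj => Lam (U 0) fun P =>
        let N := Sheafification I T P
        let Q := ExCover I T P
        -- Extension along the unit, available because `Q` is a sheaf.
        rightInv 0 (N ⇒ₐ Q) (P ⇒ₐ Q)
          (fun f => Lam P fun x => f ⬝ₐ nullUnit 0 I (truncFam I T) P x)
          (cst .nullRec 0 0 ⬝ₐ I ⬝ₐ truncFam I T ⬝ₐ P ⬝ₐ Q ⬝ₐ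
            (coverSheaf ⬝ₐ I ⬝ₐ T ⬝ₐ hT ⬝ₐ hproj ⬝ₐ P)) ⬝ₐ
          (unitCover ⬝ₐ I ⬝ₐ T ⬝ₐ hunit ⬝ₐ P)) (by decide +kernel)
  exact .mp (by decide +kernel) (.mp (by decide +kernel) h unitCover_inhabited)
    coverSheaf_inhabited

/-- `∃ (i : I), (T i → P)` implies the sheafification of the proposition `P`. -/
def CoverToSheaf : ATerm :=
  Pi (U 0) fun I => Pi (I ⇒ₐ U 0) fun T => Pi (U 0) fun P => IsProp 0 P ⇒ₐ
    ExCover I T P ⇒ₐ Sheafification I T P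

theorem coverToSheaf_inhabited : CoverToSheaf.Inhabited := by
  have h : (NullProp ⇒ₐ CoverToSheaf).Inhabited :=
    .of_checks (Lam NullProp fun nullProp => Lam (U 0) fun I => Lam (I ⇒ₐ U 0) fun T =>
      Lam (U 0) fun P => Lam (IsProp 0 P) fun hP => Lam (ExCover I T P) fun z =>
        let N := Sheafification I T P
        let hN := nullProp ⬝ₐ I ⬝ₐ truncFam I T ⬝ₐ P ⬝ₐ hP
        exRec 0 0 I (fun i => T ⬝ₐ i ⇒ₐ P) N hN
          -- The inverse of the diagonal `N → (‖T i‖ → N)` is applied to the map induced by `f`;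
          -- truncation is eliminated because `N` is a proposition.
          (fun i f => rightInv 0 N (Trunc 0 (T ⬝ₐ i) ⇒ₐ N)
              (fun y => Lam (Trunc 0 (T ⬝ₐ i)) fun _ => y)
              (cst .nullIsNull 0 0 ⬝ₐ I ⬝ₐ truncFam I T ⬝ₐ P ⬝ₐ i) ⬝ₐ
            (Lam (Trunc 0 (T ⬝ₐ i)) fun t => truncRec 0 0 (T ⬝ₐ i) N hN
              (fun t => nullUnit 0 I (truncFam I T) P (f ⬝ₐ t)) t)) z)
      (by decide +kernel)
  exact .mp (by decide +kernel) h nullProp_inhabited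

/-! ### Passage to members of `T`, and the two equalities -/

/-- The quantifier over indices implies the one over members. -/
def CoverToMemCover : ATerm :=
  Pi (U 0) fun I => Pi (I ⇒ₐ U 0) fun T => Pi (U 0) fun P => ExCover I T P ⇒ₐ ExMemCover I T P

theorem coverToMemCover_inhabited : CoverToMemCover.Inhabited :=
  .of_checks (Lam (U 0) fun I => Lam (I ⇒ₐ U 0) fun T => Lam (U 0) fun P =>
    Lam (ExCover I T P) fun z =>
      exRec 0 1 I (fun i => T ⬝ₐ i ⇒ₐ P) (ExMemCover I T P)
        (exProp 1 (U 0) fun A => Prod 1 (Mem I T A) (A ⇒ₐ P))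
        (fun i f => exIntro 1 (U 0) (fun A => Prod 1 (Mem I T A) (A ⇒ₐ P)) (T ⬝ₐ i)
          (Pair 1 (Mem I T (T ⬝ₐ i)) (fun _ => T ⬝ₐ i ⇒ₐ P) (memSelf I T i) f)) z)
    (by decide +kernel)

/-- The quantifier over members implies the one over indices. -/
def MemCoverToCover : ATerm :=
  Pi (U 0) fun I => Pi (I ⇒ₐ U 0) fun T => Pi (U 0) fun P => ExMemCover I T P ⇒ₐ ExCover I T P

theorem memCoverToCover_inhabited : MemCoverToCover.Inhabited := by
  have h : (MemCover ⇒ₐ MemCoverToCover).Inhabited :=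
    .of_checks (Lam MemCover fun memCover => Lam (U 0) fun I => Lam (I ⇒ₐ U 0) fun T =>
      Lam (U 0) fun P => Lam (ExMemCover I T P) fun z =>
        exRec 1 0 (U 0) (fun A => Prod 1 (Mem I T A) (A ⇒ₐ P)) (ExCover I T P)
          (exProp 0 I fun i => T ⬝ₐ i ⇒ₐ P)
          (fun A w => sigRec 1 0 (Mem I T A) (fun _ => A ⇒ₐ P) (ExCover I T P)
            (fun hA f => memCover ⬝ₐ I ⬝ₐ T ⬝ₐ P ⬝ₐ A ⬝ₐ hA ⬝ₐ f) w) z)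
      (by decide +kernel)
  exact .mp (by decide +kernel) h memCover_inhabited

/-- The sheafification of a proposition with respect to a projective presentation, over the lowest
universe. -/
def SheafificationEq : ATerm :=
  Pi (U 0) fun I => Pi (I ⇒ₐ U 0) fun T => IsProjectivePresentation I T ⇒ₐ
    Pi (U 0) fun P => IsProp 0 P ⇒ₐ
      Prod 2 (Id 1 (U 0) (Sheafification I T P) (ExCover I T P))
        (Id 2 (U 1) (Sheafification I T P) (ExMemCover I T P))

/-- The equality over the index type. -/
def SheafEqCover : ATerm :=
  Pi (U 0) fun I => Pi (I ⇒ₐ U 0) fun T => HasUnit I T ⇒ₐ HasSigma I T ⇒ₐ AllProjective I T ⇒ₐ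
    Pi (U 0) fun P => IsProp 0 P ⇒ₐ Id 1 (U 0) (Sheafification I T P) (ExCover I T P)

theorem sheafEqCover_inhabited : SheafEqCover.Inhabited := by
  have h : (PropExt 0 ⇒ₐ NullProp ⇒ₐ SheafToCover ⇒ₐ CoverToSheaf ⇒ₐ SheafEqCover).Inhabited :=
    .of_checks (Lam (PropExt 0) fun propExt => Lam NullProp fun nullProp =>
      Lam SheafToCover fun sheafToCover => Lam CoverToSheaf fun coverToSheaf =>
      Lam (U 0) fun I => Lam (I ⇒ₐ U 0) fun T => Lam (HasUnit I T) fun hunit =>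
      Lam (HasSigma I T) fun hT => Lam (AllProjective I T) fun hproj => Lam (U 0) fun P =>
      Lam (IsProp 0 P) fun hP =>
        propExt ⬝ₐ Sheafification I T P ⬝ₐ ExCover I T P ⬝ₐ
          (nullProp ⬝ₐ I ⬝ₐ truncFam I T ⬝ₐ P ⬝ₐ hP) ⬝ₐ (exProp 0 I fun i => T ⬝ₐ i ⇒ₐ P) ⬝ₐ
          (sheafToCover ⬝ₐ I ⬝ₐ T ⬝ₐ hunit ⬝ₐ hT ⬝ₐ hproj ⬝ₐ P) ⬝ₐ
          (coverToSheaf ⬝ₐ I ⬝ₐ T ⬝ₐ P ⬝ₐ hP)) (by decide +kernel)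
  exact .mp (by decide +kernel) (.mp (by decide +kernel) (.mp (by decide +kernel)
    (.mp (by decide +kernel) h propExt_inhabited) nullProp_inhabited) sheafToCover_inhabited)
    coverToSheaf_inhabited

/-- The equality over the members. -/
def SheafEqMemCover : ATerm :=
  Pi (U 0) fun I => Pi (I ⇒ₐ U 0) fun T => HasUnit I T ⇒ₐ HasSigma I T ⇒ₐ AllProjective I T ⇒ₐ
    Pi (U 0) fun P => IsProp 0 P ⇒ₐ Id 2 (U 1) (Sheafification I T P) (ExMemCover I T P)

theorem sheafEqMemCover_inhabited : SheafEqMemCover.Inhabited := by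
  have h : (PropExt 1 ⇒ₐ NullProp ⇒ₐ SheafToCover ⇒ₐ CoverToSheaf ⇒ₐ CoverToMemCover ⇒ₐ
      MemCoverToCover ⇒ₐ SheafEqMemCover).Inhabited :=
    .of_checks (Lam (PropExt 1) fun propExt => Lam NullProp fun nullProp =>
      Lam SheafToCover fun sheafToCover => Lam CoverToSheaf fun coverToSheaf =>
      Lam CoverToMemCover fun coverToMemCover => Lam MemCoverToCover fun memCoverToCover =>
      Lam (U 0) fun I => Lam (I ⇒ₐ U 0) fun T => Lam (HasUnit I T) fun hunit =>
      Lam (HasSigma I T) fun hT => Lam (AllProjective I T) fun hproj => Lam (U 0) fun P =>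
      Lam (IsProp 0 P) fun hP =>
        propExt ⬝ₐ Sheafification I T P ⬝ₐ ExMemCover I T P ⬝ₐ
          -- `PropExt 1` asks for `IsProp 1` where `nullProp` gives `IsProp 0`; the two have the
          -- same erasure, and the sheafification lies in `U 1` by cumulativity.
          (nullProp ⬝ₐ I ⬝ₐ truncFam I T ⬝ₐ P ⬝ₐ hP) ⬝ₐ
          (exProp 1 (U 0) fun A => Prod 1 (Mem I T A) (A ⇒ₐ P)) ⬝ₐ
          (Lam (Sheafification I T P) fun z => coverToMemCover ⬝ₐ I ⬝ₐ T ⬝ₐ P ⬝ₐ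
            (sheafToCover ⬝ₐ I ⬝ₐ T ⬝ₐ hunit ⬝ₐ hT ⬝ₐ hproj ⬝ₐ P ⬝ₐ z)) ⬝ₐ
          (Lam (ExMemCover I T P) fun z => coverToSheaf ⬝ₐ I ⬝ₐ T ⬝ₐ P ⬝ₐ hP ⬝ₐ
            (memCoverToCover ⬝ₐ I ⬝ₐ T ⬝ₐ P ⬝ₐ z))) (by decide +kernel)
  exact .mp (by decide +kernel) (.mp (by decide +kernel) (.mp (by decide +kernel)
    (.mp (by decide +kernel) (.mp (by decide +kernel) (.mp (by decide +kernel) h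
    propExt_inhabited_one) nullProp_inhabited) sheafToCover_inhabited)
    coverToSheaf_inhabited) coverToMemCover_inhabited) memCoverToCover_inhabited

theorem sheafificationEq_inhabited : SheafificationEq.Inhabited := by
  have h : (SheafEqCover ⇒ₐ SheafEqMemCover ⇒ₐ SheafificationEq).Inhabited :=
    .of_checks (Lam SheafEqCover fun eqCover => Lam SheafEqMemCover fun eqMemCover =>
      Lam (U 0) fun I => Lam (I ⇒ₐ U 0) fun T => Lam (IsProjectivePresentation I T) fun s =>
      Lam (U 0) fun P => Lam (IsProp 0 P) fun hP =>
        let pres := fst 1 (IsPresentation I T) (fun _ => AllProjective I T) s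
        let hproj := snd 1 (IsPresentation I T) (fun _ => AllProjective I T) s
        let hunit := fst 1 (HasUnit I T) (fun _ => HasSigma I T) pres
        let hT := snd 1 (HasUnit I T) (fun _ => HasSigma I T) pres
        Pair 2 (Id 1 (U 0) (Sheafification I T P) (ExCover I T P))
          (fun _ => Id 2 (U 1) (Sheafification I T P) (ExMemCover I T P))
          (eqCover ⬝ₐ I ⬝ₐ T ⬝ₐ hunit ⬝ₐ hT ⬝ₐ hproj ⬝ₐ P ⬝ₐ hP)
          (eqMemCover ⬝ₐ I ⬝ₐ T ⬝ₐ hunit ⬝ₐ hT ⬝ₐ hproj ⬝ₐ P ⬝ₐ hP)) (by decide +kernel)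
  exact .mp (by decide +kernel) (.mp (by decide +kernel) h sheafEqCover_inhabited)
    sheafEqMemCover_inhabited

end ATerm
end HoTT

open HoTT in
/-- It is a theorem of homotopy type theory that, for every collection of types `T : I → U k`
that is a projective presentation and every proposition `P : U k`, the `T`-sheafification of `P`
equals `∃ (A ∈ T), (A → P)`. The quantifier over the members of `T` is rendered both as one over
the index type, where the equality is one in `U k`, and as one over the types `A : U k` with
`A ∈ T`, where the right-hand side, and so the equality, lives in the next universe. -/
theorem mainTheorem2 (k : ℕ) :
    HoTT.Provable
      (HoTT.Pi (U k) fun I => HoTT.Pi (I ⇒ U k) fun T => IsProjectivePresentation k I T ⇒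
        HoTT.Pi (U k) fun P => IsProp P ⇒
          HoTT.Prod
            (HoTT.Id (U k) (Sheafification I T P) (Ex I fun i => T ⬝ i ⇒ P))
            (HoTT.Id (U (k + 1)) (Sheafification I T P)
              (Ex (U k) fun A => HoTT.Prod (Mem k I T A) (A ⇒ P)))) := by
  obtain ⟨t, ht⟩ := ATerm.sheafificationEq_inhabited
  -- After erasing and shifting by `k`, the level-zero statement is definitionally the one over `U
  -- k`.
  exact ⟨_, ht.shift k⟩
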